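/- A binary XOS valuation on the item set $[m]=\{1,\dots,m\}$ is given by a non-empty finite family of subsets (clauses) $A_1,\dots,A_a\subseteq[m]$; its value on $S\subseteq[m]$ is $\max_i|A_i\cap S|$. In the BXOS decision problem with target $X$, Alice holds a binary XOS valuation with clauses $A_1,\dots,A_a$ and Bob one with clauses $B_1,\dots,B_b$; both know $X$. For $\alpha>0$, an answer is acceptable for $\alpha$-approximation if it is "yes" whenever $\max_{i,j}|A_i\cup B_j|\ge X$ and "no" whenever $\max_{i,j}|A_i\cup B_j|<\alpha X$ (any answer is acceptable in between). In a simultaneous randomized protocol, Alice and Bob each send one finite bit string, which depends only on their own valuation and on the (public or private) randomness, and an auctioneer answers on the basis of the two strings and the randomness; its communication is the maximum, over all inputs and all outcomes of the randomness, of the total number of bits sent. **Theorem.** Let $\varepsilon>0$, $\alpha=\frac34-\frac1{108}+\varepsilon$ and $C=2\varepsilon^2$. For every $m$ there is a probability distribution $D$ over pairs of binary XOS valuations on $[m]$ such that every simultaneous randomized protocol with communication less than $e^{2Cm/9}$ gives an acceptable answer for $\alpha$-approximation to the BXOS decision problem with target $X=m$ with probability at most $\frac12+2e^{-Cm/9}$,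 over the input drawn from $D$ and the randomness of the protocol, which is independent of the input. -/

import Mathlib

/-- A binary XOS valuation on the item set `[m] = Fin m`, given (as in the input of the BXOS
decision problem) by a non-empty finite family of clauses, i.e. subsets `A_1, ..., A_a` of `[m]`.
A party sees the whole family, including its order and its repetitions. -/
structure BinaryXOS (m : ℕ) where
  numClauses : ℕ
  numClauses_pos : 0 < numClauses
  clause : Fin numClauses → Finset (Fin m)

namespace BinaryXOS

variable {m : ℕ}

/-- The value `v(S) = max_i |A_i ∩ S|` of a bundle `S`. -/
def value (v : BinaryXOS m) (S : Finset (Fin m)) : ℕ :=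
  Finset.univ.sup fun i => (v.clause i ∩ S).card

/-- The optimum of the decision problem: `max_{i,j} |A_i ∪ B_j|`. -/
def maxUnion (v w : BinaryXOS m) : ℕ :=
  Finset.univ.sup fun p : Fin v.numClauses × Fin w.numClauses =>
    (v.clause p.1 ∪ w.clause p.2).card

/-- `max_{i,j} |A_i ∪ B_j|` is the optimal social welfare
`SW*(v, w) = max_{S ∩ T = ∅} v(S) + w(T)`. -/
theorem isGreatest_maxUnion (v w : BinaryXOS m) :
    IsGreatest {x : ℕ | ∃ S T : Finset (Fin m), Disjoint S T ∧ x = v.value S + w.value T}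
      (v.maxUnion w) := by
  have : Nonempty (Fin v.numClauses) := ⟨⟨0, v.numClauses_pos⟩⟩
  have : Nonempty (Fin w.numClauses) := ⟨⟨0, w.numClauses_pos⟩⟩
  have upper : ∀ S T : Finset (Fin m), Disjoint S T →
      v.value S + w.value T ≤ v.maxUnion w := by
    intro S T hST
    obtain ⟨i, -, hi⟩ := Finset.exists_mem_eq_sup Finset.univ Finset.univ_nonempty
      (fun i => (v.clause i ∩ S).card)
    obtain ⟨j, -, hj⟩ := Finset.exists_mem_eq_sup Finset.univ Finset.univ_nonempty
      (fun j => (w.clause j ∩ T).card)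
    have hd : Disjoint (v.clause i ∩ S) (w.clause j ∩ T) :=
      hST.mono Finset.inter_subset_right Finset.inter_subset_right
    calc v.value S + w.value T
        = (v.clause i ∩ S).card + (w.clause j ∩ T).card := by
          unfold value; rw [hi, hj]
      _ = ((v.clause i ∩ S) ∪ (w.clause j ∩ T)).card := (Finset.card_union_of_disjoint hd).symm
      _ ≤ (v.clause i ∪ w.clause j).card := Finset.card_le_card
          (Finset.union_subset_union Finset.inter_subset_left Finset.inter_subset_left)
      _ ≤ v.maxUnion w := Finset.le_sup
          (f := fun p : Fin v.numClauses × Fin w.numClauses =>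
            (v.clause p.1 ∪ w.clause p.2).card) (Finset.mem_univ (i, j))
  refine ⟨?_, ?_⟩
  · obtain ⟨⟨i, j⟩, -, hij⟩ := Finset.exists_mem_eq_sup Finset.univ Finset.univ_nonempty
      (fun p : Fin v.numClauses × Fin w.numClauses => (v.clause p.1 ∪ w.clause p.2).card)
    refine ⟨v.clause i, (v.clause i)ᶜ, disjoint_compl_right, le_antisymm ?_ ?_⟩
    · have h1 : (v.clause i ∩ v.clause i).card ≤ v.value (v.clause i) := Finset.le_sup
        (f := fun k => (v.clause k ∩ v.clause i).card) (Finset.mem_univ i)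
      have h2 : (w.clause j ∩ (v.clause i)ᶜ).card ≤ w.value (v.clause i)ᶜ := Finset.le_sup
        (f := fun k => (w.clause k ∩ (v.clause i)ᶜ).card) (Finset.mem_univ j)
      have h3 : v.clause i ∪ w.clause j
          = (v.clause i ∩ v.clause i) ∪ (w.clause j ∩ (v.clause i)ᶜ) := by
        ext x; simp; tauto
      have h4 : v.maxUnion w = (v.clause i ∪ w.clause j).card := hij
      rw [h4, h3]
      exact (Finset.card_union_le _ _).trans (Nat.add_le_add h1 h2)
    · exact upper _ _ disjoint_compl_right
  · rintro x ⟨S, T, hST, rfl⟩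
    exact upper S T hST

end BinaryXOS

/-- `answer` (`true` is "yes") is acceptable for the BXOS decision problem with target `X` and
approximation factor `α` on the input `(v, w)`: "yes" if `max |A_i ∪ B_j| ≥ X`, "no" if
`max |A_i ∪ B_j| < α X`, anything in between. -/
def IsCorrectAnswer {m : ℕ} (α X : ℝ) (v w : BinaryXOS m) (answer : Bool) : Prop :=
  (X ≤ (v.maxUnion w : ℝ) → answer = true) ∧ ((v.maxUnion w : ℝ) < α * X → answer = false)

/-- A simultaneous (one-round) randomized protocol. `Ω` carries all the randomness and is visible
to everybody; private coins are the special case in which `Ω` is a product and each of the three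
maps uses only some of the coordinates. Alice and Bob each send a finite bit string that depends
on their own valuation only, and the auctioneer answers on the basis of the two strings.
The target `X` is fixed and known to everybody, so all three maps may depend on it. -/
structure SimultaneousProtocol (m : ℕ) (Ω : Type*) [MeasurableSpace Ω] where
  alice : BinaryXOS m → Ω → List Bool
  bob : BinaryXOS m → Ω → List Bool
  output : List Bool → List Bool → Ω → Bool
  measurableSet_alice : ∀ v x, MeasurableSet {ω | alice v ω = x}
  measurableSet_bob : ∀ w y, MeasurableSet {ω | bob w ω = y}
  measurableSet_output : ∀ x y, MeasurableSet {ω | output x y ω = true}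

namespace SimultaneousProtocol

variable {m : ℕ} {Ω : Type*} [MeasurableSpace Ω]

/-- The auctioneer's answer on the input `(v, w)` with randomness `ω`. -/
def answer (P : SimultaneousProtocol m Ω) (v w : BinaryXOS m) (ω : Ω) : Bool :=
  P.output (P.alice v ω) (P.bob w ω) ω

/-- The worst-case communication, in bits, is less than `c`. -/
def CommunicationLT (P : SimultaneousProtocol m Ω) (c : ℝ) : Prop :=
  ∀ v w ω, (((P.alice v ω).length + (P.bob w ω).length : ℕ) : ℝ) < c

/-- The probability, over the input drawn from `D` and the independent randomness of the
protocol, that the answer is acceptable. -/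
noncomputable def successProb (P : SimultaneousProtocol m Ω) (μ : MeasureTheory.Measure Ω)
    (D : PMF (BinaryXOS m × BinaryXOS m)) (α X : ℝ) : ENNReal :=
  ∑' p : BinaryXOS m × BinaryXOS m,
    D p * μ {ω | IsCorrectAnswer α X p.1 p.2 (P.answer p.1 p.2 ω)}

end SimultaneousProtocol

open MeasureTheory

/-! Each item carries a pair of correlated types, `s` for Alice and `t` for Bob. Given the types,
each party draws `N` independent clauses item by item. With probability 1/2 nothing more happens;
otherwise a clause `z` and its complement are planted at random positions in the two families, which
makes the optimum `m`. The joint law of `(s, t, z)` is chosen so that, given `s` alone, `z` is a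
typical clause of Alice, and given `t` alone, its complement is a typical clause of Bob. So neither
party can tell which clause is planted, or whether one is.

Two independent clauses of densities `a` and `1 - a` would miss an item with probability at most
1/4. The correlation of the types raises this to 7/27, hence the ratio 20/27 = 3/4 - 1/108.
Hoeffding and a union bound over the `N ^ 2` pairs show that unplanted inputs rarely have a union of
size at least `(20/27 + ε) m`.

A message with few values reveals little about a random one of `N` independent clauses
(`sum_prod_mul_sub_mean_le`). Hence unplanting first Alice's clause and then Bob's hardly changes
the probability of "yes" (`plantedMean_sub_freshMean_le`). A correct protocol would have to change
its answer, so its success probability is close to 1/2. -/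

/-! ### Finite product laws. -/

theorem sum_pi_prod {ι κ : Type*} [Fintype ι] [DecidableEq ι] [Fintype κ] (g : ι → κ → ℝ) :
    ∑ f : ι → κ, ∏ i, g i (f i) = ∏ i, ∑ j, g i j := by
  classical
  rw [Finset.prod_univ_sum, Fintype.piFinset_univ]

theorem sum_pi_prod_eq_one {ι κ : Type*} [Fintype ι] [DecidableEq ι] [Fintype κ] {p : κ → ℝ}
    (hp : ∑ x, p x = 1) : ∑ f : ι → κ, ∏ i, p (f i) = 1 := by
  rw [sum_pi_prod fun _ => p]; simp [hp]

/-- Exchanging a coordinate of a product sample with a fresh sample does not change the law. -/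
theorem sum_update_mul_prod {ι κ : Type*} [Fintype ι] [DecidableEq ι] [Fintype κ] {p : κ → ℝ}
    (hp : ∑ x, p x = 1) (I : ι) (G : κ → (ι → κ) → ℝ) :
    ∑ a, ∑ x : ι → κ, p a * (∏ i, p (x i)) * G a (Function.update x I a)
      = ∑ x : ι → κ, (∏ i, p (x i)) * G (x I) x := by
  have hprod : ∀ (x : ι → κ) (a : κ),
      p (x I) * ∏ i, p (Function.update x I a i) = p a * ∏ i, p (x i) := by
    intro x a
    rw [← Finset.mul_prod_erase Finset.univ _ (Finset.mem_univ I),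
      ← Finset.mul_prod_erase Finset.univ (fun i => p (x i)) (Finset.mem_univ I),
      Function.update_self, Finset.prod_congr rfl fun i hi => by
        rw [Function.update_of_ne (Finset.ne_of_mem_erase hi)]]
    ring
  -- Swapping the fresh sample with coordinate `I` is an involution that preserves the joint weight.
  have hinv : Function.Involutive
      (fun q : κ × (ι → κ) => (q.2 I, Function.update q.2 I q.1)) := by
    rintro ⟨a, x⟩; simp
  have key : ∑ q : κ × (ι → κ), p q.1 * (∏ i, p (q.2 i)) * G q.1 (Function.update q.2 I q.1)
      = ∑ q : κ × (ι → κ), p q.1 * (∏ i, p (q.2 i)) * G (q.2 I) q.2 := by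
    refine Fintype.sum_equiv hinv.toPerm _ _ ?_
    rintro ⟨a, x⟩
    simp [Function.Involutive.coe_toPerm, hprod]
  rw [Fintype.sum_prod_type, Fintype.sum_prod_type] at key
  rw [key]
  calc _ = ∑ a, p a * ∑ x : ι → κ, (∏ i, p (x i)) * G (x I) x := by
        refine Finset.sum_congr rfl fun a _ => ?_
        rw [Finset.mul_sum]
        exact Finset.sum_congr rfl fun x _ => by ring
    _ = _ := by rw [← Finset.sum_mul, hp, one_mul]

theorem sum_prod_mul_eval {ι κ : Type*} [Fintype ι] [DecidableEq ι] [Fintype κ] {p : κ → ℝ}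
    (hp : ∑ x, p x = 1) (I : ι) (G : κ → ℝ) :
    ∑ x : ι → κ, (∏ i, p (x i)) * G (x I) = ∑ a, p a * G a := by
  rw [← sum_update_mul_prod hp I fun a _ => G a]
  refine Finset.sum_congr rfl fun a _ => ?_
  rw [← Finset.sum_mul, ← Finset.mul_sum, sum_pi_prod_eq_one hp, mul_one]

/-! ### Hoeffding's lemma for finite laws. -/

/-- Hoeffding's lemma for a Bernoulli variable. -/
theorem one_sub_add_mul_exp_le {q : ℝ} (h0 : 0 ≤ q) (h1 : q ≤ 1) (l : ℝ) :
    1 - q + q * Real.exp l ≤ Real.exp (l * q + l ^ 2 / 8) := by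
  have hw : ∑ b : Bool, ENNReal.ofReal (cond b q (1 - q)) = 1 := by
    simp [← ENNReal.ofReal_add h0 (sub_nonneg.2 h1)]
  set μ := (PMF.ofFintype _ hw).toMeasure with hμ
  set X : Bool → ℝ := fun b => cond b 1 0 with hX
  have hE : ∫ b, X b ∂μ = q := by
    rw [hμ, PMF.integral_eq_sum]
    simp [hX, h0]
  have h := (ProbabilityTheory.hasSubgaussianMGF_of_mem_Icc (μ := μ) (X := X) (a := 0) (b := 1)
    (measurable_of_finite X).aemeasurable
    (Filter.Eventually.of_forall fun b => by cases b <;> simp [hX])).mgf_le l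
  rw [hE, ProbabilityTheory.mgf, hμ, PMF.integral_eq_sum] at h
  simp only [Fintype.sum_bool, PMF.ofFintype_apply, hX, cond_true, cond_false, smul_eq_mul,
    ENNReal.toReal_ofReal h0, ENNReal.toReal_ofReal (sub_nonneg.2 h1)] at h
  have e3 : ((((‖(1 : ℝ) - 0‖₊ / 2) ^ 2 : NNReal) : ℝ)) * l ^ 2 / 2 = l ^ 2 / 8 := by
    simp; ring
  rw [e3] at h
  calc 1 - q + q * Real.exp l
      = Real.exp (l * q) *
          (q * Real.exp (l * (1 - q)) + (1 - q) * Real.exp (l * (0 - q))) := by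
        have a1 : Real.exp (l * q) * Real.exp (l * (1 - q)) = Real.exp l := by
          rw [← Real.exp_add]; ring_nf
        have a2 : Real.exp (l * q) * Real.exp (l * (0 - q)) = 1 := by
          rw [← Real.exp_add, ← Real.exp_zero]; ring_nf
        linear_combination (-q) * a1 - (1 - q) * a2
    _ ≤ Real.exp (l * q) * Real.exp (l ^ 2 / 8) := by gcongr
    _ = _ := (Real.exp_add _ _).symm

/-- Hoeffding's lemma for a finitely supported law. -/
theorem sum_mul_exp_sub_mean_le {κ : Type*} [Fintype κ] {p g : κ → ℝ} (hp0 : ∀ x, 0 ≤ p x)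
    (hp : ∑ x, p x = 1) (hg0 : ∀ x, 0 ≤ g x) (hg1 : ∀ x, g x ≤ 1) (l : ℝ) :
    ∑ x, p x * Real.exp (l * (g x - ∑ y, p y * g y)) ≤ Real.exp (l ^ 2 / 8) := by
  set q := ∑ y, p y * g y with hq
  have hq0 : 0 ≤ q := Finset.sum_nonneg fun x _ => mul_nonneg (hp0 x) (hg0 x)
  have hq1 : q ≤ 1 := by
    rw [← hp]; exact Finset.sum_le_sum fun x _ => mul_le_of_le_one_right (hp0 x) (hg1 x)
  -- By convexity, the Bernoulli law of the same mean has the largest exponential moment.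
  have hconv : ∀ x, Real.exp (l * g x) ≤ 1 - g x + g x * Real.exp l := by
    intro x
    have h := convexOn_exp.2 (Set.mem_univ (0 : ℝ)) (Set.mem_univ l)
      (sub_nonneg.2 (hg1 x)) (hg0 x) (by ring)
    simpa [mul_comm l] using h
  calc ∑ x, p x * Real.exp (l * (g x - q))
      = Real.exp (-(l * q)) * ∑ x, p x * Real.exp (l * g x) := by
        rw [Finset.mul_sum]
        refine Finset.sum_congr rfl fun x _ => ?_
        rw [mul_left_comm, ← Real.exp_add]; ring_nf
    _ ≤ Real.exp (-(l * q)) * ∑ x, p x * (1 - g x + g x * Real.exp l) := by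
        gcongr with x
        · exact hp0 x
        · exact hconv x
    _ = Real.exp (-(l * q)) * (1 - q + q * Real.exp l) := by
        congr 1
        calc _ = ∑ x, (p x - p x * g x + p x * g x * Real.exp l) :=
              Finset.sum_congr rfl fun x _ => by ring
          _ = _ := by
            rw [Finset.sum_add_distrib, Finset.sum_sub_distrib, hp, hq, Finset.sum_mul]
    _ ≤ Real.exp (-(l * q)) * Real.exp (l * q + l ^ 2 / 8) := by
        gcongr; exact one_sub_add_mul_exp_le hq0 hq1 l
    _ = _ := by rw [← Real.exp_add]; ring_nf

/-! ### Few-valued functions of a product sample. -/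

/-- A function `f` with few values, applied to a product sample, is nearly independent of a
random coordinate of the sample. -/
theorem sum_prod_mul_sub_mean_le {ι κ M : Type*} [Fintype ι] [DecidableEq ι] [Fintype κ]
    {p : κ → ℝ} (hp0 : ∀ x, 0 ≤ p x) (hp : ∑ x, p x = 1) (φ : κ → M → ℝ)
    (hφ0 : ∀ x a, 0 ≤ φ x a) (hφ1 : ∀ x a, φ x a ≤ 1) (f : (ι → κ) → M) (s : Finset M)
    (hf : ∀ x, f x ∈ s) {l : ℝ} (hl : 0 < l) :
    ∑ x : ι → κ, (∏ i, p (x i)) * ∑ i, (φ (x i) (f x) - ∑ y, p y * φ y (f x))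
      ≤ (Real.log s.card + Fintype.card ι * (l ^ 2 / 8)) / l := by
  have hκ : Nonempty κ := by
    by_contra h
    rw [not_nonempty_iff] at h
    simp at hp
  have hs : (0 : ℝ) < s.card := by
    exact_mod_cast Finset.card_pos.2 ⟨_, hf fun _ => hκ.some⟩
  set c := Real.log s.card + Fintype.card ι * (l ^ 2 / 8) with hc
  set Z : M → (ι → κ) → ℝ := fun a x => ∑ i, (φ (x i) a - ∑ y, p y * φ y a) with hZ
  have hpp : ∀ x : ι → κ, 0 ≤ ∏ i, p (x i) := fun x => Finset.prod_nonneg fun i _ => hp0 _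
  -- For a fixed value `a` the summands of `Z a` are independent and centred.
  have hmgf : ∀ a, ∑ x : ι → κ, (∏ i, p (x i)) * Real.exp (l * Z a x)
      ≤ Real.exp (Fintype.card ι * (l ^ 2 / 8)) := by
    intro a
    calc ∑ x : ι → κ, (∏ i, p (x i)) * Real.exp (l * Z a x)
        = ∑ x : ι → κ, ∏ i, p (x i) * Real.exp (l * (φ (x i) a - ∑ y, p y * φ y a)) := by
          refine Finset.sum_congr rfl fun x _ => ?_
          rw [Finset.prod_mul_distrib, ← Real.exp_sum, hZ, Finset.mul_sum]
      _ = (∑ y, p y * Real.exp (l * (φ y a - ∑ y, p y * φ y a))) ^ Fintype.card ι := by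
          rw [sum_pi_prod fun _ y => p y * Real.exp (l * (φ y a - ∑ y, p y * φ y a))]
          simp
      _ ≤ Real.exp (l ^ 2 / 8) ^ Fintype.card ι := by
          gcongr
          · exact Finset.sum_nonneg fun x _ => mul_nonneg (hp0 x) (Real.exp_nonneg _)
          · exact sum_mul_exp_sub_mean_le hp0 hp (fun x => hφ0 x a) (fun x => hφ1 x a) l
      _ = _ := by rw [← Real.exp_nat_mul]
  -- `f x` depends on the sample, so its exponential is bounded by the sum over all values in `s`;
  -- this costs the factor `s.card`, absorbed in `c`.
  have hexp : ∑ x : ι → κ, (∏ i, p (x i)) * Real.exp (l * Z (f x) x - c) ≤ 1 := by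
    calc ∑ x : ι → κ, (∏ i, p (x i)) * Real.exp (l * Z (f x) x - c)
        ≤ ∑ x : ι → κ, ∑ a ∈ s, (∏ i, p (x i)) * Real.exp (l * Z a x) * Real.exp (-c) := by
          refine Finset.sum_le_sum fun x _ => ?_
          rw [sub_eq_add_neg, Real.exp_add, ← mul_assoc]
          exact Finset.single_le_sum
            (f := fun a => (∏ i, p (x i)) * Real.exp (l * Z a x) * Real.exp (-c))
            (fun a _ => mul_nonneg (mul_nonneg (hpp x) (Real.exp_nonneg _)) (Real.exp_nonneg _))
            (hf x)
      _ = ∑ a ∈ s, (∑ x : ι → κ, (∏ i, p (x i)) * Real.exp (l * Z a x)) * Real.exp (-c) := by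
          rw [Finset.sum_comm]
          simp_rw [Finset.sum_mul]
      _ ≤ ∑ a ∈ s, Real.exp (Fintype.card ι * (l ^ 2 / 8)) * Real.exp (-c) := by
          gcongr with a
          exact hmgf a
      _ = 1 := by
          rw [Finset.sum_const, nsmul_eq_mul, ← Real.exp_add, hc]
          nth_rewrite 1 [← Real.exp_log hs]
          rw [← Real.exp_add, ← Real.exp_zero]; ring_nf
  -- The inequality `u + 1 ≤ exp u` plays the role of Jensen's inequality.
  have hlin : ∑ x : ι → κ, (∏ i, p (x i)) * (l * Z (f x) x - c + 1) ≤ 1 :=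
    le_trans (Finset.sum_le_sum fun x _ =>
      mul_le_mul_of_nonneg_left (Real.add_one_le_exp _) (hpp x)) hexp
  have hexpand : ∑ x : ι → κ, (∏ i, p (x i)) * (l * Z (f x) x - c + 1)
      = l * (∑ x : ι → κ, (∏ i, p (x i)) * Z (f x) x) - c + 1 := by
    have h1 := sum_pi_prod_eq_one (ι := ι) hp
    calc _ = ∑ x : ι → κ, (l * ((∏ i, p (x i)) * Z (f x) x) + (∏ i, p (x i)) * (1 - c)) :=
          Finset.sum_congr rfl fun x _ => by ring
      _ = _ := by rw [Finset.sum_add_distrib, ← Finset.mul_sum, ← Finset.sum_mul, h1]; ring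
  rw [le_div_iff₀ hl]
  rw [hexpand] at hlin
  linarith

/-- Planting in a random coordinate of a product sample a point that is correlated with some side
information `θ` is hard to notice from few values of `f`. -/
theorem sum_planted_sub_le {S X Θ M ι : Type*} [Fintype S] [Fintype X] [Fintype Θ] [Fintype ι]
    [DecidableEq ι] [Nonempty ι] {w : S → ℝ} {p : S → X → ℝ} {ν : S → X → Θ → ℝ}
    (hw0 : ∀ s, 0 ≤ w s) (hw : ∑ s, w s = 1) (hp0 : ∀ s x, 0 ≤ p s x) (hp : ∀ s, ∑ x, p s x = 1)
    (hν0 : ∀ s x θ, 0 ≤ ν s x θ) (hν : ∀ s x, ∑ θ, ν s x θ = w s * p s x)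
    (F : S → X → Θ → M → ℝ) (hF0 : ∀ s x θ a, 0 ≤ F s x θ a) (hF1 : ∀ s x θ a, F s x θ a ≤ 1)
    (f : (ι → X) → M) (A : Finset M) (hf : ∀ x, f x ∈ A) {l : ℝ} (hl : 0 < l) :
    ∑ s, ∑ a, ∑ θ, ν s a θ *
        ((Fintype.card ι : ℝ)⁻¹ *
            ∑ I, ∑ x : ι → X, (∏ i, p s (x i)) * F s a θ (f (Function.update x I a))
          - ∑ x : ι → X, (∏ i, p s (x i)) * F s a θ (f x))
      ≤ (Fintype.card ι : ℝ)⁻¹ * ((Real.log A.card + Fintype.card ι * (l ^ 2 / 8)) / l) := by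
  set N := (Fintype.card ι : ℝ) with hN
  have hNpos : 0 < N := by rw [hN]; exact_mod_cast Fintype.card_pos
  set B := (Real.log A.card + N * (l ^ 2 / 8)) / l with hB
  -- The conditional mean of `F` over `θ` given `s` and `a`. Where the denominator vanishes so does
  -- the numerator, and the default value 0 is harmless.
  set K : S → X → M → ℝ := fun s a m => (∑ θ, ν s a θ * F s a θ m) / (w s * p s a) with hK
  have hwp : ∀ s a, 0 ≤ w s * p s a := fun s a => mul_nonneg (hw0 s) (hp0 s a)
  have hle : ∀ s a m, ∑ θ, ν s a θ * F s a θ m ≤ w s * p s a := fun s a m => by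
    rw [← hν]
    exact Finset.sum_le_sum fun θ _ => mul_le_of_le_one_right (hν0 s a θ) (hF1 s a θ m)
  have hnn : ∀ s a m, 0 ≤ ∑ θ, ν s a θ * F s a θ m := fun s a m =>
    Finset.sum_nonneg fun θ _ => mul_nonneg (hν0 s a θ) (hF0 s a θ m)
  have hK0 : ∀ s a m, 0 ≤ K s a m := fun s a m => div_nonneg (hnn s a m) (hwp s a)
  have hK1 : ∀ s a m, K s a m ≤ 1 := fun s a m => div_le_one_of_le₀ (hle s a m) (hwp s a)
  have hKmul : ∀ s a m, w s * p s a * K s a m = ∑ θ, ν s a θ * F s a θ m := by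
    intro s a m
    by_cases h : w s * p s a = 0
    · rw [h, zero_mul]
      exact le_antisymm (hnn s a m) (h ▸ hle s a m)
    · exact mul_div_cancel₀ _ h
  have hfresh : ∀ s, ∑ a, ∑ θ, ν s a θ * ∑ x : ι → X, (∏ i, p s (x i)) * F s a θ (f x)
      = w s * ∑ x : ι → X, (∏ i, p s (x i)) * ∑ a, p s a * K s a (f x) := by
    intro s
    calc _ = ∑ a, ∑ x : ι → X, (∏ i, p s (x i)) * ∑ θ, ν s a θ * F s a θ (f x) := by
          refine Finset.sum_congr rfl fun a _ => ?_
          simp_rw [Finset.mul_sum]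
          rw [Finset.sum_comm]
          exact Finset.sum_congr rfl fun x _ => Finset.sum_congr rfl fun θ _ => by ring
      _ = _ := by
          rw [Finset.sum_comm, Finset.mul_sum]
          refine Finset.sum_congr rfl fun x _ => ?_
          simp_rw [← hKmul, Finset.mul_sum]
          exact Finset.sum_congr rfl fun a _ => by ring
  -- Given `s`, the planted point has the law of any other coordinate, so planting it amounts to
  -- reading coordinate `I` of an unplanted sample.
  have hplant : ∀ s I, ∑ a, ∑ θ, ν s a θ *
        ∑ x : ι → X, (∏ i, p s (x i)) * F s a θ (f (Function.update x I a))
      = w s * ∑ x : ι → X, (∏ i, p s (x i)) * K s (x I) (f x) := by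
    intro s I
    calc _ = ∑ a, ∑ x : ι → X, (∏ i, p s (x i)) *
            ∑ θ, ν s a θ * F s a θ (f (Function.update x I a)) := by
          refine Finset.sum_congr rfl fun a _ => ?_
          simp_rw [Finset.mul_sum]
          rw [Finset.sum_comm]
          exact Finset.sum_congr rfl fun x _ => Finset.sum_congr rfl fun θ _ => by ring
      _ = w s * ∑ a, ∑ x : ι → X, p s a * (∏ i, p s (x i)) *
            K s a (f (Function.update x I a)) := by
          simp_rw [← hKmul, Finset.mul_sum]
          exact Finset.sum_congr rfl fun a _ => Finset.sum_congr rfl fun x _ => by ring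
      _ = _ := by rw [sum_update_mul_prod (hp s) I fun a x => K s a (f x)]
  have hs : ∀ s, ∑ a, ∑ θ, ν s a θ *
        (N⁻¹ * ∑ I, ∑ x : ι → X, (∏ i, p s (x i)) * F s a θ (f (Function.update x I a))
          - ∑ x : ι → X, (∏ i, p s (x i)) * F s a θ (f x))
      = w s * (N⁻¹ * ∑ x : ι → X, (∏ i, p s (x i)) *
          ∑ i, (K s (x i) (f x) - ∑ y, p s y * K s y (f x))) := by
    intro s
    calc _ = N⁻¹ * ∑ I, (∑ a, ∑ θ, ν s a θ *
            ∑ x : ι → X, (∏ i, p s (x i)) * F s a θ (f (Function.update x I a)))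
          - ∑ a, ∑ θ, ν s a θ * ∑ x : ι → X, (∏ i, p s (x i)) * F s a θ (f x) := by
          rw [Finset.sum_comm (s := (Finset.univ : Finset ι)), Finset.mul_sum,
            ← Finset.sum_sub_distrib]
          refine Finset.sum_congr rfl fun a _ => ?_
          rw [Finset.sum_comm (s := (Finset.univ : Finset ι)), Finset.mul_sum,
            ← Finset.sum_sub_distrib]
          refine Finset.sum_congr rfl fun θ _ => ?_
          rw [← Finset.mul_sum]
          ring
      _ = _ := by
          simp_rw [hplant, hfresh, Finset.sum_sub_distrib, mul_sub, Finset.sum_sub_distrib,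
            Finset.sum_const, Finset.card_univ, nsmul_eq_mul, mul_sub, ← Finset.mul_sum]
          congr 1
          · rw [Finset.sum_comm]
            simp_rw [Finset.mul_sum]
            refine Finset.sum_congr rfl fun _ _ => Finset.sum_congr rfl fun _ _ => by ring
          · rw [← hN]
            simp_rw [mul_left_comm _ N, ← Finset.mul_sum]
            field_simp
  calc _ = ∑ s, w s * (N⁻¹ * ∑ x : ι → X, (∏ i, p s (x i)) *
          ∑ i, (K s (x i) (f x) - ∑ y, p s y * K s y (f x))) :=
        Finset.sum_congr rfl fun s _ => hs s
    _ ≤ ∑ s, w s * (N⁻¹ * B) := by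
        gcongr with s
        · exact hw0 s
        · exact sum_prod_mul_sub_mean_le (hp0 s) (hp s) (K s) (hK0 s) (hK1 s) f A hf hl
    _ = N⁻¹ * B := by rw [← Finset.sum_mul, hw, one_mul]

/-! ### Planted against independent families. -/

section

variable {S T X ι : Type*} [Fintype S] [Fintype T] [Fintype X] [Fintype ι] [DecidableEq ι]

/-- The mean of `G` when the two families have independent clauses, given their types. -/
noncomputable def freshMean (ν : S → T → X → ℝ) (p : S → X → ℝ) (q : T → X → ℝ)
    (G : (ι → X) → (ι → X) → ℝ) : ℝ :=
  ∑ s, ∑ t, ∑ z, ν s t z *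
    ∑ x : ι → X, (∏ i, p s (x i)) * ∑ y : ι → X, (∏ j, q t (y j)) * G x y

/-- The mean of `G` when the clauses `z` and `e z` are planted in the two families. -/
noncomputable def plantedMean (ν : S → T → X → ℝ) (p : S → X → ℝ) (q : T → X → ℝ) (e : X ≃ X)
    (G : (ι → X) → (ι → X) → ℝ) : ℝ :=
  ∑ s, ∑ t, ∑ z, ν s t z *
    ((Fintype.card ι : ℝ)⁻¹ * ∑ I, ∑ x : ι → X, (∏ i, p s (x i)) *
      ((Fintype.card ι : ℝ)⁻¹ * ∑ J, ∑ y : ι → X, (∏ j, q t (y j)) *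
        G (Function.update x I z) (Function.update y J (e z))))

/-- A hybrid argument that removes one planted clause at a time. The marginal conditions `hνS` and
`hνT` make each removal an instance of `sum_planted_sub_le`, with the other party's type as side
information. -/
theorem plantedMean_sub_freshMean_le {MA MB : Type*} [Nonempty ι] {ν : S → T → X → ℝ}
    {p : S → X → ℝ} {q : T → X → ℝ} {wS : S → ℝ} {wT : T → ℝ} (e : X ≃ X)
    (hwS0 : ∀ s, 0 ≤ wS s) (hwS : ∑ s, wS s = 1) (hwT0 : ∀ t, 0 ≤ wT t) (hwT : ∑ t, wT t = 1)
    (hp0 : ∀ s x, 0 ≤ p s x) (hp : ∀ s, ∑ x, p s x = 1)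
    (hq0 : ∀ t x, 0 ≤ q t x) (hq : ∀ t, ∑ x, q t x = 1)
    (hν0 : ∀ s t z, 0 ≤ ν s t z) (hνS : ∀ s z, ∑ t, ν s t z = wS s * p s z)
    (hνT : ∀ t z, ∑ s, ν s t z = wT t * q t (e z))
    (h : MA → MB → ℝ) (hh0 : ∀ a b, 0 ≤ h a b) (hh1 : ∀ a b, h a b ≤ 1)
    (f : (ι → X) → MA) (g : (ι → X) → MB) (A : Finset MA) (B : Finset MB)
    (hf : ∀ x, f x ∈ A) (hg : ∀ x, g x ∈ B) {l : ℝ} (hl : 0 < l) :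
    plantedMean ν p q e (fun x y => h (f x) (g y)) - freshMean ν p q (fun x y => h (f x) (g y))
      ≤ (Fintype.card ι : ℝ)⁻¹ * ((Real.log A.card + Fintype.card ι * (l ^ 2 / 8)) / l)
        + (Fintype.card ι : ℝ)⁻¹ * ((Real.log B.card + Fintype.card ι * (l ^ 2 / 8)) / l) := by
  have hP : ∀ s, ∑ x : ι → X, ∏ i, p s (x i) = 1 := fun s => sum_pi_prod_eq_one (hp s)
  have hQ : ∀ t, ∑ x : ι → X, ∏ i, q t (x i) = 1 := fun t => sum_pi_prod_eq_one (hq t)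
  have hP0 : ∀ s (x : ι → X), 0 ≤ ∏ i, p s (x i) := fun s x => Finset.prod_nonneg fun i _ => hp0 _ _
  have hQ0 : ∀ t (x : ι → X), 0 ≤ ∏ i, q t (x i) := fun t x => Finset.prod_nonneg fun i _ => hq0 _ _
  have hN : (0 : ℝ) < Fintype.card ι := by exact_mod_cast Fintype.card_pos
  have hone : ∀ (P : (ι → X) → ℝ) (G : (ι → X) → ℝ), (∀ x, 0 ≤ P x) → ∑ x, P x = 1 →
      (∀ x, G x ≤ 1) → ∑ x, P x * G x ≤ 1 := by
    intro P G h0 h1 hG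
    rw [← h1]
    exact Finset.sum_le_sum fun x _ => mul_le_of_le_one_right (h0 x) (hG x)
  -- Unplant Alice's clause while Bob's stays planted.
  have h1 := sum_planted_sub_le (ι := ι) (p := p) (ν := fun s z t => ν s t z) hwS0 hwS hp0 hp
    (fun s z t => hν0 s t z) hνS
    (fun _ z t a => (Fintype.card ι : ℝ)⁻¹ * ∑ J, ∑ y : ι → X, (∏ j, q t (y j)) *
      h a (g (Function.update y J (e z))))
    (fun s z t a => mul_nonneg (inv_nonneg.2 hN.le) (Finset.sum_nonneg fun J _ =>
      Finset.sum_nonneg fun y _ => mul_nonneg (hQ0 t y) (hh0 _ _)))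
    (fun s z t a => by
      rw [inv_mul_le_iff₀ hN, mul_one]
      calc _ ≤ ∑ _J : ι, (1 : ℝ) := Finset.sum_le_sum fun J _ =>
            hone _ _ (hQ0 t) (hQ t) fun y => hh1 _ _
        _ = _ := by simp)
    f A hf hl
  -- Unplant Bob's clause, now that Alice's family is fresh; the law is reparametrised by `y = e z`.
  have h2 := sum_planted_sub_le (ι := ι) (p := q) (ν := fun t y s => ν s t (e.symm y))
    hwT0 hwT hq0 hq (fun t y s => hν0 s t _) (fun t y => by simp [hνT])
    (fun _ _ s b => ∑ x : ι → X, (∏ i, p s (x i)) * h (f x) b)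
    (fun t y s b => Finset.sum_nonneg fun x _ => mul_nonneg (hP0 s x) (hh0 _ _))
    (fun t y s b => hone _ _ (hP0 s) (hP s) fun x => hh1 _ _)
    g B hg hl
  refine le_trans (le_of_eq ?_) (add_le_add h1 h2)
  have r1 : ∀ G : S → T → X → ℝ, ∑ s, ∑ z, ∑ t, G s t z = ∑ s, ∑ t, ∑ z, G s t z :=
    fun G => Finset.sum_congr rfl fun s _ => Finset.sum_comm
  have r2 : ∀ G : S → T → X → ℝ, ∑ t, ∑ y, ∑ s, G s t (e.symm y) = ∑ s, ∑ t, ∑ z, G s t z := by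
    intro G
    rw [Finset.sum_comm (s := (Finset.univ : Finset S))]
    refine Finset.sum_congr rfl fun t _ => ?_
    rw [Finset.sum_comm (s := (Finset.univ : Finset S))]
    exact e.symm.sum_comp fun z => ∑ s, G s t z
  have e2 : ∀ G : X → S → T → X → ℝ, ∑ t, ∑ y, ∑ s, G y s t (e.symm y)
      = ∑ s, ∑ t, ∑ z, G (e z) s t z := by
    intro G
    rw [← r2 fun s t z => G (e z) s t z]
    simp
  rw [r1 fun s t z => _, e2 fun y s t z => ν s t z * _]
  simp only [plantedMean, freshMean, ← Finset.sum_add_distrib, ← Finset.sum_sub_distrib]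
  refine Finset.sum_congr rfl fun s _ => Finset.sum_congr rfl fun t _ =>
    Finset.sum_congr rfl fun z _ => ?_
  have c1 : ∑ x : ι → X, (∏ i, p s (x i)) * ((Fintype.card ι : ℝ)⁻¹ * ∑ J, ∑ y : ι → X,
        (∏ j, q t (y j)) * h (f x) (g (Function.update y J (e z))))
      = (Fintype.card ι : ℝ)⁻¹ * ∑ J, ∑ y : ι → X, (∏ j, q t (y j)) *
        ∑ x : ι → X, (∏ i, p s (x i)) * h (f x) (g (Function.update y J (e z))) := by
    simp_rw [Finset.mul_sum]
    rw [Finset.sum_comm]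
    refine Finset.sum_congr rfl fun J _ => ?_
    rw [Finset.sum_comm]
    exact Finset.sum_congr rfl fun _ _ => Finset.sum_congr rfl fun _ _ => by ring
  have c2 : ∑ x : ι → X, (∏ i, p s (x i)) * ∑ y : ι → X, (∏ j, q t (y j)) * h (f x) (g y)
      = ∑ y : ι → X, (∏ j, q t (y j)) * ∑ x : ι → X, (∏ i, p s (x i)) * h (f x) (g y) := by
    simp_rw [Finset.mul_sum]
    rw [Finset.sum_comm]
    exact Finset.sum_congr rfl fun _ _ => Finset.sum_congr rfl fun _ _ => by ring
  rw [c1, c2]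
  ring

end

/-! ### Calculus of the two means. -/

section

variable {S T X ι : Type*} [Fintype S] [Fintype T] [Fintype X] [Fintype ι] [DecidableEq ι]

theorem freshMean_mono {ν : S → T → X → ℝ} {p : S → X → ℝ} {q : T → X → ℝ}
    (hp0 : ∀ s x, 0 ≤ p s x) (hq0 : ∀ t x, 0 ≤ q t x) (hν0 : ∀ s t z, 0 ≤ ν s t z)
    {G H : (ι → X) → (ι → X) → ℝ} (h : ∀ x y, G x y ≤ H x y) :
    freshMean ν p q G ≤ freshMean ν p q H := by
  unfold freshMean
  gcongr with s _ t _ z _ x _ y _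
  · exact hν0 s t z
  · exact Finset.prod_nonneg fun i _ => hp0 _ _
  · exact Finset.prod_nonneg fun i _ => hq0 _ _
  · exact h x y

/-- The comparison is required only at planted inputs, where the optimum is known. -/
theorem plantedMean_mono {ν : S → T → X → ℝ} {p : S → X → ℝ} {q : T → X → ℝ} {e : X ≃ X}
    (hp0 : ∀ s x, 0 ≤ p s x) (hq0 : ∀ t x, 0 ≤ q t x) (hν0 : ∀ s t z, 0 ≤ ν s t z)
    {G H : (ι → X) → (ι → X) → ℝ}
    (h : ∀ x y I J z, G (Function.update x I z) (Function.update y J (e z))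
      ≤ H (Function.update x I z) (Function.update y J (e z))) :
    plantedMean ν p q e G ≤ plantedMean ν p q e H := by
  unfold plantedMean
  gcongr with s _ t _ z _ I _ x _ J _ y _
  · exact hν0 s t z
  · exact Finset.prod_nonneg fun i _ => hp0 _ _
  · exact Finset.prod_nonneg fun i _ => hq0 _ _
  · exact h x y I J z

theorem freshMean_add (ν : S → T → X → ℝ) (p : S → X → ℝ) (q : T → X → ℝ)
    (G H : (ι → X) → (ι → X) → ℝ) :
    freshMean ν p q (fun x y => G x y + H x y) = freshMean ν p q G + freshMean ν p q H := by
  simp only [freshMean, mul_add, Finset.sum_add_distrib]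

theorem freshMean_sub (ν : S → T → X → ℝ) (p : S → X → ℝ) (q : T → X → ℝ)
    (G H : (ι → X) → (ι → X) → ℝ) :
    freshMean ν p q (fun x y => G x y - H x y) = freshMean ν p q G - freshMean ν p q H := by
  simp only [freshMean, mul_sub, Finset.sum_sub_distrib]

theorem freshMean_sum {κ : Type*} (a : Finset κ) (ν : S → T → X → ℝ) (p : S → X → ℝ)
    (q : T → X → ℝ) (G : κ → (ι → X) → (ι → X) → ℝ) :
    freshMean ν p q (fun x y => ∑ k ∈ a, G k x y) = ∑ k ∈ a, freshMean ν p q (G k) := by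
  classical
  induction a using Finset.induction_on with
  | empty => simp [freshMean]
  | insert k a hk ih => simp only [Finset.sum_insert hk, freshMean_add, ih]

theorem freshMean_eval {ν : S → T → X → ℝ} {p : S → X → ℝ} {q : T → X → ℝ}
    (hp : ∀ s, ∑ x, p s x = 1) (hq : ∀ t, ∑ x, q t x = 1) (I J : ι) (G : X → X → ℝ) :
    freshMean ν p q (fun x y => G (x I) (y J))
      = ∑ s, ∑ t, ∑ z, ν s t z * ∑ a, p s a * ∑ b, q t b * G a b := by
  unfold freshMean
  refine Finset.sum_congr rfl fun s _ => Finset.sum_congr rfl fun t _ =>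
    Finset.sum_congr rfl fun z _ => ?_
  rw [← sum_prod_mul_eval (hp s) I fun a => ∑ b, q t b * G a b]
  congr 1
  refine Finset.sum_congr rfl fun x _ => ?_
  rw [sum_prod_mul_eval (hq t) J fun b => G (x I) b]

theorem freshMean_one {ν : S → T → X → ℝ} {p : S → X → ℝ} {q : T → X → ℝ}
    (hp : ∀ s, ∑ x, p s x = 1) (hq : ∀ t, ∑ x, q t x = 1) (hν : ∑ s, ∑ t, ∑ z, ν s t z = 1) :
    freshMean ν p q (fun _ _ : ι → X => 1) = 1 := by
  simp only [freshMean, mul_one, sum_pi_prod_eq_one (hp _), sum_pi_prod_eq_one (hq _), hν]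

theorem plantedMean_one [Nonempty ι] {ν : S → T → X → ℝ} {p : S → X → ℝ} {q : T → X → ℝ}
    (e : X ≃ X) (hp : ∀ s, ∑ x, p s x = 1) (hq : ∀ t, ∑ x, q t x = 1)
    (hν : ∑ s, ∑ t, ∑ z, ν s t z = 1) :
    plantedMean ν p q e (fun _ _ : ι → X => 1) = 1 := by
  simp [plantedMean, sum_pi_prod_eq_one (hp _), sum_pi_prod_eq_one (hq _), hν]

end

/-! ### The law of a single item. -/

/-- The law of (Alice's type, Bob's type, membership in Alice's planted clause) of an item. -/
noncomputable def itemWeight (s t z : Bool) : ℝ :=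
  if s then (if t then 0 else if z then 2 / 9 else 1 / 9)
  else if t then (if z then 2 / 9 else 1 / 9) else if z then 0 else 1 / 3

noncomputable def typeWeight (s : Bool) : ℝ := if s then 1 / 3 else 2 / 3

/-- The conditional law of membership of an item in a clause of Alice, given its type `s`. -/
noncomputable def aliceWeight (s x : Bool) : ℝ := if x = s then 2 / 3 else 1 / 3

/-- The conditional law of membership of an item in a clause of Bob, given its type `t`. -/
noncomputable def bobWeight (t y : Bool) : ℝ := if y = t then 1 / 3 else 2 / 3

theorem itemWeight_nonneg (s t z : Bool) : 0 ≤ itemWeight s t z := by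
  cases s <;> cases t <;> cases z <;> norm_num [itemWeight]

theorem typeWeight_nonneg (s : Bool) : 0 ≤ typeWeight s := by
  cases s <;> norm_num [typeWeight]

theorem aliceWeight_nonneg (s x : Bool) : 0 ≤ aliceWeight s x := by
  cases s <;> cases x <;> norm_num [aliceWeight]

theorem bobWeight_nonneg (t y : Bool) : 0 ≤ bobWeight t y := by
  cases t <;> cases y <;> norm_num [bobWeight]

theorem sum_typeWeight : ∑ s, typeWeight s = 1 := by norm_num [typeWeight]

theorem sum_aliceWeight (s : Bool) : ∑ x, aliceWeight s x = 1 := by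
  cases s <;> norm_num [aliceWeight]

theorem sum_bobWeight (t : Bool) : ∑ y, bobWeight t y = 1 := by
  cases t <;> norm_num [bobWeight]

/-- Indistinguishability for Alice: without `t`, the planted clause looks like every other clause.
The next lemma is its mirror image for Bob, whose planted clause is the complement. -/
theorem sum_itemWeight_bob (s z : Bool) :
    ∑ t, itemWeight s t z = typeWeight s * aliceWeight s z := by
  cases s <;> cases z <;> norm_num [itemWeight, typeWeight, aliceWeight]

theorem sum_itemWeight_alice (t z : Bool) :
    ∑ s, itemWeight s t z = typeWeight t * bobWeight t (!z) := by
  cases t <;> cases z <;> norm_num [itemWeight, typeWeight, bobWeight]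

/-- An item is missing from two independent clauses with probability `7/27`. -/
theorem sum_itemWeight_mul_union (c : ℝ) :
    ∑ s, ∑ t, ∑ z, itemWeight s t z * ∑ a, aliceWeight s a * ∑ b, bobWeight t b *
      (if a || b then c else 1) = 1 - 20 / 27 + 20 / 27 * c := by
  simp [itemWeight, aliceWeight, bobWeight]
  ring

/-! ### Products over the items and concentration of unions. -/

section

variable (m : ℕ)

noncomputable def itemsWeight (s t z : Fin m → Bool) : ℝ := ∏ k, itemWeight (s k) (t k) (z k)

noncomputable def typesWeight (s : Fin m → Bool) : ℝ := ∏ k, typeWeight (s k)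

noncomputable def aliceClauseWeight (s x : Fin m → Bool) : ℝ := ∏ k, aliceWeight (s k) (x k)

noncomputable def bobClauseWeight (t y : Fin m → Bool) : ℝ := ∏ k, bobWeight (t k) (y k)

def boolCompl : (Fin m → Bool) ≃ (Fin m → Bool) where
  toFun z k := !z k
  invFun z k := !z k
  left_inv z := by simp
  right_inv z := by simp

variable {m}

theorem itemsWeight_nonneg (s t z : Fin m → Bool) : 0 ≤ itemsWeight m s t z :=
  Finset.prod_nonneg fun _ _ => itemWeight_nonneg _ _ _

theorem typesWeight_nonneg (s : Fin m → Bool) : 0 ≤ typesWeight m s :=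
  Finset.prod_nonneg fun _ _ => typeWeight_nonneg _

theorem aliceClauseWeight_nonneg (s x : Fin m → Bool) : 0 ≤ aliceClauseWeight m s x :=
  Finset.prod_nonneg fun _ _ => aliceWeight_nonneg _ _

theorem bobClauseWeight_nonneg (t y : Fin m → Bool) : 0 ≤ bobClauseWeight m t y :=
  Finset.prod_nonneg fun _ _ => bobWeight_nonneg _ _

theorem sum_typesWeight : ∑ s, typesWeight m s = 1 := sum_pi_prod_eq_one sum_typeWeight

theorem sum_aliceClauseWeight (s : Fin m → Bool) : ∑ x, aliceClauseWeight m s x = 1 := by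
  simp only [aliceClauseWeight, sum_pi_prod fun k x => aliceWeight (s k) x, sum_aliceWeight,
    Finset.prod_const_one]

theorem sum_bobClauseWeight (t : Fin m → Bool) : ∑ y, bobClauseWeight m t y = 1 := by
  simp only [bobClauseWeight, sum_pi_prod fun k y => bobWeight (t k) y, sum_bobWeight,
    Finset.prod_const_one]

theorem sum_itemsWeight_bob (s z : Fin m → Bool) :
    ∑ t, itemsWeight m s t z = typesWeight m s * aliceClauseWeight m s z := by
  simp only [itemsWeight, sum_pi_prod fun k t => itemWeight (s k) t (z k), sum_itemWeight_bob,
    Finset.prod_mul_distrib, typesWeight, aliceClauseWeight]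

theorem sum_itemsWeight_alice (t z : Fin m → Bool) :
    ∑ s, itemsWeight m s t z = typesWeight m t * bobClauseWeight m t (boolCompl m z) := by
  simp only [itemsWeight, sum_pi_prod fun k s => itemWeight s (t k) (z k), sum_itemWeight_alice,
    Finset.prod_mul_distrib, typesWeight, bobClauseWeight, boolCompl, Equiv.coe_fn_mk]

theorem sum_itemsWeight : ∑ s, ∑ t, ∑ z, itemsWeight m s t z = 1 := by
  calc _ = ∑ s, ∑ z, ∑ t, itemsWeight m s t z :=
        Finset.sum_congr rfl fun s _ => Finset.sum_comm
    _ = 1 := by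
      simp_rw [sum_itemsWeight_bob, ← Finset.mul_sum, sum_aliceClauseWeight, mul_one,
        sum_typesWeight]

/-- The number of items in the union of two clauses. -/
def unionCard (a b : Fin m → Bool) : ℕ := (Finset.univ.filter fun k => (a k || b k) = true).card

theorem exp_mul_unionCard (l : ℝ) (a b : Fin m → Bool) :
    Real.exp (l * unionCard a b) = ∏ k, if a k || b k then Real.exp l else 1 := by
  rw [Finset.prod_ite, Finset.prod_const, Finset.prod_const_one, mul_one, unionCard, mul_comm,
    Real.exp_nat_mul]

/-- The exponential moments of the size of the union of two independent clauses. -/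
theorem sum_exp_mul_unionCard (l : ℝ) :
    ∑ s, ∑ t, ∑ z, itemsWeight m s t z * ∑ a, aliceClauseWeight m s a *
      ∑ b, bobClauseWeight m t b * Real.exp (l * unionCard a b)
      = (1 - 20 / 27 + 20 / 27 * Real.exp l) ^ m := by
  rw [← sum_itemWeight_mul_union (Real.exp l)]
  simp only [exp_mul_unionCard, itemsWeight, aliceClauseWeight, bobClauseWeight,
    ← Finset.prod_mul_distrib]
  have h1 : ∀ t a : Fin m → Bool,
      ∑ b : Fin m → Bool, ∏ k, (bobWeight (t k) (b k) * if a k || b k then Real.exp l else 1)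
      = ∏ k, ∑ b, bobWeight (t k) b * if a k || b then Real.exp l else 1 := fun t a =>
    sum_pi_prod fun k b => bobWeight (t k) b * if a k || b then Real.exp l else 1
  simp only [h1, ← Finset.prod_mul_distrib]
  have h2 : ∀ s t : Fin m → Bool, ∑ a : Fin m → Bool, ∏ k, (aliceWeight (s k) (a k) *
        ∑ b, bobWeight (t k) b * if a k || b then Real.exp l else 1)
      = ∏ k, ∑ a, aliceWeight (s k) a *
        ∑ b, bobWeight (t k) b * if a || b then Real.exp l else 1 := fun s t =>
    sum_pi_prod fun k a => aliceWeight (s k) a *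
        ∑ b, bobWeight (t k) b * if a || b then Real.exp l else 1
  simp only [h2, ← Finset.prod_mul_distrib]
  set Q : Bool → Bool → ℝ := fun s t => ∑ a, aliceWeight s a *
    ∑ b, bobWeight t b * if a || b then Real.exp l else 1
  change ∑ s : Fin m → Bool, ∑ t : Fin m → Bool, ∑ z : Fin m → Bool,
    ∏ k, (itemWeight (s k) (t k) (z k) * Q (s k) (t k))
      = (∑ s, ∑ t, ∑ z, itemWeight s t z * Q s t) ^ m
  have h3 : ∀ s t : Fin m → Bool, ∑ z : Fin m → Bool,
      ∏ k, (itemWeight (s k) (t k) (z k) * Q (s k) (t k))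
      = ∏ k, ∑ z, itemWeight (s k) (t k) z * Q (s k) (t k) := fun s t =>
    sum_pi_prod fun k z => itemWeight (s k) (t k) z * Q (s k) (t k)
  have h4 : ∀ s : Fin m → Bool, ∑ t : Fin m → Bool,
      ∏ k, ∑ z, itemWeight (s k) (t k) z * Q (s k) (t k)
      = ∏ k, ∑ t, ∑ z, itemWeight (s k) t z * Q (s k) t := fun s =>
    sum_pi_prod fun k t => ∑ z, itemWeight (s k) t z * Q (s k) t
  simp only [h3, h4, sum_pi_prod fun (_ : Fin m) s => ∑ t, ∑ z, itemWeight s t z * Q s t,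
    Finset.prod_const, Finset.card_univ, Fintype.card_fin]

/-- The union bound over all pairs of clauses of two independent families. -/
theorem freshMean_exists_le {N : ℕ} {ε : ℝ} (hε : 0 < ε) :
    freshMean (ι := Fin N) (itemsWeight m) (aliceClauseWeight m) (bobClauseWeight m)
      (fun x y => ∑ I, ∑ J, if (20 / 27 + ε) * m ≤ (unionCard (x I) (y J) : ℝ) then 1 else 0)
      ≤ (N : ℝ) ^ 2 * Real.exp (-(2 * ε ^ 2 * m)) := by
  set c := (20 / 27 + ε) * m with hc
  have hpair : ∀ I J : Fin N,
      freshMean (ι := Fin N) (itemsWeight m) (aliceClauseWeight m) (bobClauseWeight m)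
        (fun x y => if c ≤ (unionCard (x I) (y J) : ℝ) then 1 else 0)
        ≤ Real.exp (-(2 * ε ^ 2 * m)) := by
    intro I J
    -- Chernoff bound; the parameter `l = 4 * ε` minimises `-l * ε + l ^ 2 / 8`.
    calc _ ≤ freshMean (ι := Fin N) (itemsWeight m) (aliceClauseWeight m) (bobClauseWeight m)
          (fun x y => Real.exp (-(4 * ε * c)) * Real.exp (4 * ε * unionCard (x I) (y J))) := by
          refine freshMean_mono aliceClauseWeight_nonneg bobClauseWeight_nonneg
            itemsWeight_nonneg fun x y => ?_
          rw [← Real.exp_add]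
          split_ifs with h
          · rw [Real.one_le_exp_iff]
            nlinarith
          · exact Real.exp_nonneg _
      _ = Real.exp (-(4 * ε * c)) * (1 - 20 / 27 + 20 / 27 * Real.exp (4 * ε)) ^ m := by
          rw [freshMean_eval sum_aliceClauseWeight sum_bobClauseWeight I J fun a b =>
            Real.exp (-(4 * ε * c)) * Real.exp (4 * ε * unionCard a b), ← sum_exp_mul_unionCard]
          simp only [mul_left_comm _ (Real.exp (-(4 * ε * c))), ← Finset.mul_sum]
      _ ≤ Real.exp (-(4 * ε * c)) * Real.exp (4 * ε * (20 / 27) + (4 * ε) ^ 2 / 8) ^ m := by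
          gcongr
          exact one_sub_add_mul_exp_le (by norm_num) (by norm_num) _
      _ = _ := by
          rw [← Real.exp_nat_mul, ← Real.exp_add, hc]
          ring_nf
  simp only [freshMean_sum]
  calc _ ≤ ∑ _I : Fin N, ∑ _J : Fin N, Real.exp (-(2 * ε ^ 2 * m)) :=
        Finset.sum_le_sum fun I _ => Finset.sum_le_sum fun J _ => hpair I J
    _ = _ := by simp; ring

end

/-! ### Counting messages. -/

theorem exists_finset_list_length_le (k : ℕ) :
    ∃ A : Finset (List Bool), (∀ x, x.length ≤ k → x ∈ A) ∧
      Real.log A.card ≤ (k + 1) * Real.log 2 := by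
  classical
  refine ⟨(Finset.range (k + 1)).biUnion fun n =>
    Finset.univ.image fun v : List.Vector Bool n => v.1, fun x hx => ?_, ?_⟩
  · simp only [Finset.mem_biUnion, Finset.mem_range, Finset.mem_image, Finset.mem_univ, true_and]
    exact ⟨x.length, by omega, ⟨x, rfl⟩, rfl⟩
  · set A := (Finset.range (k + 1)).biUnion fun n =>
      Finset.univ.image fun v : List.Vector Bool n => v.1
    have hcard : A.card ≤ 2 ^ (k + 1) := by
      calc A.card ≤ ∑ n ∈ Finset.range (k + 1), 2 ^ n := by
            refine Finset.card_biUnion_le.trans (Finset.sum_le_sum fun n _ => ?_)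
            refine Finset.card_image_le.trans ?_
            simp [card_vector]
        _ ≤ 2 ^ (k + 1) := by
            rw [Nat.geomSum_eq le_rfl]; simp
    rcases Nat.eq_zero_or_pos A.card with h | h
    · rw [h]; simp; positivity
    · calc Real.log A.card ≤ Real.log ((2 : ℝ) ^ (k + 1)) :=
            Real.log_le_log (by exact_mod_cast h) (by exact_mod_cast hcard)
        _ = _ := by rw [Real.log_pow]; push_cast; ring

/-! ### Valuations built from families of clauses. -/

/-- The binary XOS valuation with the clauses `{k | x i k}`. -/
def BinaryXOS.ofFamily {m N : ℕ} (hN : 0 < N) (x : Fin N → Fin m → Bool) : BinaryXOS m where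
  numClauses := N
  numClauses_pos := hN
  clause i := Finset.univ.filter fun k => x i k = true

theorem card_clause_union {m N : ℕ} (hN : 0 < N) (x y : Fin N → Fin m → Bool) (I J : Fin N) :
    ((BinaryXOS.ofFamily hN x).clause I ∪ (BinaryXOS.ofFamily hN y).clause J).card
      = unionCard (x I) (y J) := by
  simp only [BinaryXOS.ofFamily, unionCard, ← Finset.filter_or, Bool.or_eq_true]

theorem unionCard_le_maxUnion {m N : ℕ} (hN : 0 < N) (x y : Fin N → Fin m → Bool) (I J : Fin N) :
    unionCard (x I) (y J)
      ≤ (BinaryXOS.ofFamily hN x).maxUnion (BinaryXOS.ofFamily hN y) := by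
  rw [← card_clause_union hN]
  exact Finset.le_sup (f := fun p : Fin N × Fin N =>
    ((BinaryXOS.ofFamily hN x).clause p.1 ∪ (BinaryXOS.ofFamily hN y).clause p.2).card)
    (Finset.mem_univ (I, J))

theorem exists_unionCard_eq_maxUnion {m N : ℕ} (hN : 0 < N) (x y : Fin N → Fin m → Bool) :
    ∃ I J, (BinaryXOS.ofFamily hN x).maxUnion (BinaryXOS.ofFamily hN y)
      = unionCard (x I) (y J) := by
  obtain ⟨⟨I, J⟩, -, h⟩ := Finset.exists_mem_eq_sup
    (Finset.univ : Finset (Fin N × Fin N)) ⟨(⟨0, hN⟩, ⟨0, hN⟩), Finset.mem_univ _⟩ fun p =>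
    ((BinaryXOS.ofFamily hN x).clause p.1 ∪ (BinaryXOS.ofFamily hN y).clause p.2).card
  exact ⟨I, J, h.trans (card_clause_union hN x y I J)⟩

theorem unionCard_boolCompl {m : ℕ} (z : Fin m → Bool) : unionCard z (boolCompl m z) = m := by
  simp [unionCard, boolCompl]

/-! ### Fixing the randomness of the protocol. -/

namespace SimultaneousProtocol

variable {m : ℕ} {Ω : Type*} [MeasurableSpace Ω] (P : SimultaneousProtocol m Ω)

theorem measurable_answer (v w : BinaryXOS m) : Measurable (P.answer v w) := by
  refine measurable_to_bool ?_
  have h : P.answer v w ⁻¹' {true} = ⋃ x, ⋃ y,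
      ({ω | P.alice v ω = x} ∩ {ω | P.bob w ω = y}) ∩ {ω | P.output x y ω = true} := by
    ext ω
    simp [answer]
  rw [h]
  exact MeasurableSet.iUnion fun x => MeasurableSet.iUnion fun y =>
    ((P.measurableSet_alice v x).inter (P.measurableSet_bob w y)).inter
      (P.measurableSet_output x y)

theorem measurableSet_isCorrectAnswer (α X : ℝ) (v w : BinaryXOS m) :
    MeasurableSet {ω | IsCorrectAnswer α X v w (P.answer v w ω)} :=
  P.measurable_answer v w (MeasurableSet.of_discrete (s := {b | IsCorrectAnswer α X v w b}))

open Classical in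
/-- A bound for every fixed value of the randomness bounds the success probability. -/
theorem successProb_map_le (μ : Measure Ω) [IsProbabilityMeasure μ] {Θ : Type*} [Fintype Θ]
    {W : Θ → ℝ} (hW0 : ∀ θ, 0 ≤ W θ) (hW : ∑ θ, ENNReal.ofReal (W θ) = 1)
    (inst : Θ → BinaryXOS m × BinaryXOS m) (α X B : ℝ)
    (hB : ∀ ω, ∑ θ, W θ * (if IsCorrectAnswer α X (inst θ).1 (inst θ).2
      (P.answer (inst θ).1 (inst θ).2 ω) then 1 else 0) ≤ B) :
    P.successProb μ ((PMF.ofFintype _ hW).map inst) α X ≤ ENNReal.ofReal B := by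
  set E : BinaryXOS m × BinaryXOS m → Set Ω :=
    fun p => {ω | IsCorrectAnswer α X p.1 p.2 (P.answer p.1 p.2 ω)} with hE
  have hEm : ∀ p, MeasurableSet (E p) := fun p => P.measurableSet_isCorrectAnswer α X p.1 p.2
  calc P.successProb μ ((PMF.ofFintype _ hW).map inst) α X
      = ∑' p, ∑ θ, (if p = inst θ then ENNReal.ofReal (W θ) else 0) * μ (E p) := by
        refine tsum_congr fun p => ?_
        rw [PMF.map_apply, tsum_fintype, ← Finset.sum_mul]
        simp only [PMF.ofFintype_apply, hE]
        congr!
    _ = ∑ θ, ENNReal.ofReal (W θ) * μ (E (inst θ)) := by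
        rw [Summable.tsum_finsetSum fun _ _ => ENNReal.summable]
        refine Finset.sum_congr rfl fun θ _ => ?_
        rw [tsum_eq_single (inst θ) fun p hp => by rw [if_neg hp, zero_mul], if_pos rfl]
    _ = ∫⁻ ω, ∑ θ, ENNReal.ofReal (W θ) * (E (inst θ)).indicator 1 ω ∂μ := by
        rw [lintegral_finsetSum _ fun θ _ =>
          ((measurable_one.indicator (hEm _)).const_mul _)]
        refine Finset.sum_congr rfl fun θ _ => ?_
        rw [lintegral_const_mul _ (measurable_one.indicator (hEm _)),
          lintegral_indicator_one (hEm _)]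
    _ ≤ ∫⁻ _, ENNReal.ofReal B ∂μ := by
        refine lintegral_mono fun ω => ?_
        refine le_trans (le_of_eq ?_) (ENNReal.ofReal_le_ofReal (hB ω))
        rw [ENNReal.ofReal_sum_of_nonneg fun θ _ => mul_nonneg (hW0 θ) (by split_ifs <;> simp)]
        refine Finset.sum_congr rfl fun θ _ => ?_
        rw [ENNReal.ofReal_mul (hW0 θ)]
        congr 1
        by_cases h : ω ∈ E (inst θ)
        · have h' : IsCorrectAnswer α X (inst θ).1 (inst θ).2 _ := h
          rw [Set.indicator_of_mem h, if_pos h']; simp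
        · have h' : ¬ IsCorrectAnswer α X (inst θ).1 (inst θ).2 _ := h
          rw [Set.indicator_of_notMem h, if_neg h']; simp
    _ = ENNReal.ofReal B := by simp

end SimultaneousProtocol

/-! ### The hard input distribution. -/

section

variable {S T X ι : Type*} [Fintype S] [Fintype T] [Fintype X] [Fintype ι] [DecidableEq ι]

/-- The seeds of an input: on the left the types, the planted clause, its two positions and the
other clauses; on the right the same without the positions. -/
abbrev Seed (S T X ι : Type*) : Type _ :=
  (S × T × X × ι × ι × (ι → X) × (ι → X)) ⊕ (S × T × X × (ι → X) × (ι → X))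

noncomputable def seedWeight (ν : S → T → X → ℝ) (p : S → X → ℝ) (q : T → X → ℝ) :
    Seed S T X ι → ℝ
  | .inl (s, t, z, _, _, x, y) => 1 / 2 * (ν s t z * ((Fintype.card ι : ℝ)⁻¹ *
      ((∏ i, p s (x i)) * ((Fintype.card ι : ℝ)⁻¹ * ∏ j, q t (y j)))))
  | .inr (s, t, z, x, y) => 1 / 2 * (ν s t z * ((∏ i, p s (x i)) * ∏ j, q t (y j)))

def seedFamilies (e : X ≃ X) : Seed S T X ι → (ι → X) × (ι → X)
  | .inl (_, _, z, I, J, x, y) => (Function.update x I z, Function.update y J (e z))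
  | .inr (_, _, _, x, y) => (x, y)

theorem sum_seedWeight_mul (ν : S → T → X → ℝ) (p : S → X → ℝ) (q : T → X → ℝ) (e : X ≃ X)
    (G : (ι → X) → (ι → X) → ℝ) :
    ∑ θ : Seed S T X ι, seedWeight ν p q θ * G (seedFamilies e θ).1 (seedFamilies e θ).2
      = 1 / 2 * (plantedMean ν p q e G + freshMean ν p q G) := by
  rw [Fintype.sum_sum_type, mul_add, plantedMean, freshMean, Finset.mul_sum, Finset.mul_sum]
  simp only [Fintype.sum_prod_type, seedWeight, seedFamilies]
  refine congrArg₂ (· + ·) ?_ ?_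
  · refine Finset.sum_congr rfl fun s _ => ?_
    rw [Finset.mul_sum]
    refine Finset.sum_congr rfl fun t _ => ?_
    rw [Finset.mul_sum]
    refine Finset.sum_congr rfl fun z _ => ?_
    rw [Finset.mul_sum, Finset.mul_sum, Finset.mul_sum]
    refine Finset.sum_congr rfl fun I _ => ?_
    rw [Finset.sum_comm, Finset.mul_sum, Finset.mul_sum, Finset.mul_sum]
    refine Finset.sum_congr rfl fun x _ => ?_
    rw [Finset.mul_sum, Finset.mul_sum, Finset.mul_sum, Finset.mul_sum, Finset.mul_sum]
    refine Finset.sum_congr rfl fun J _ => ?_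
    rw [Finset.mul_sum, Finset.mul_sum, Finset.mul_sum, Finset.mul_sum, Finset.mul_sum]
    exact Finset.sum_congr rfl fun y _ => by ring
  · refine Finset.sum_congr rfl fun s _ => ?_
    rw [Finset.mul_sum]
    refine Finset.sum_congr rfl fun t _ => ?_
    rw [Finset.mul_sum]
    refine Finset.sum_congr rfl fun z _ => ?_
    rw [Finset.mul_sum, Finset.mul_sum]
    refine Finset.sum_congr rfl fun x _ => ?_
    rw [Finset.mul_sum, Finset.mul_sum, Finset.mul_sum]
    exact Finset.sum_congr rfl fun y _ => by ring

end

theorem seedWeight_nonneg {S T X ι : Type*} [Fintype ι] {ν : S → T → X → ℝ} {p : S → X → ℝ} {q : T → X → ℝ}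
    (hp0 : ∀ s x, 0 ≤ p s x) (hq0 : ∀ t x, 0 ≤ q t x) (hν0 : ∀ s t z, 0 ≤ ν s t z)
    (θ : Seed S T X ι) : 0 ≤ seedWeight ν p q θ := by
  have hP : ∀ s (x : ι → X), 0 ≤ ∏ i, p s (x i) := fun s x => Finset.prod_nonneg fun i _ => hp0 _ _
  have hQ : ∀ t (x : ι → X), 0 ≤ ∏ i, q t (x i) := fun t x => Finset.prod_nonneg fun i _ => hq0 _ _
  rcases θ with ⟨s, t, z, _, _, x, y⟩ | ⟨s, t, z, x, y⟩ <;>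
  · have := hν0 s t z
    have := hP s x
    have := hQ t y
    simp only [seedWeight]
    positivity

section

variable (m N : ℕ)

theorem sum_ofReal_seedWeight (hN : 0 < N) :
    ∑ θ : Seed (Fin m → Bool) (Fin m → Bool) (Fin m → Bool) (Fin N),
      ENNReal.ofReal (seedWeight (itemsWeight m) (aliceClauseWeight m) (bobClauseWeight m) θ)
      = 1 := by
  have : Nonempty (Fin N) := ⟨⟨0, hN⟩⟩
  have h := sum_seedWeight_mul (ι := Fin N) (itemsWeight m) (aliceClauseWeight m)
    (bobClauseWeight m) (boolCompl m) fun _ _ => 1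
  rw [plantedMean_one _ sum_aliceClauseWeight sum_bobClauseWeight sum_itemsWeight,
    freshMean_one sum_aliceClauseWeight sum_bobClauseWeight sum_itemsWeight] at h
  simp only [mul_one] at h
  rw [← ENNReal.ofReal_sum_of_nonneg fun θ _ => seedWeight_nonneg aliceClauseWeight_nonneg
    bobClauseWeight_nonneg itemsWeight_nonneg θ, h]
  norm_num

/-- With probability `1/2` each, two families of `N` clauses with a planted complementary pair,
and two families of `N` clauses that are independent given the types of the items. -/
noncomputable def hardDistribution (hN : 0 < N) : PMF (BinaryXOS m × BinaryXOS m) :=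
  (PMF.ofFintype _ (sum_ofReal_seedWeight m N hN)).map fun θ =>
    (BinaryXOS.ofFamily hN (seedFamilies (boolCompl m) θ).1,
      BinaryXOS.ofFamily hN (seedFamilies (boolCompl m) θ).2)

variable {m N}

/-! ### Success probability on the hard distribution. -/

/-- For fixed `ω` the longest messages of Alice and of Bob occur together on some input, so their
lengths sum to less than `c`. The 2 arises because all strings of length up to `k` are counted,
fewer than `2 ^ (k + 1)`. -/
theorem SimultaneousProtocol.exists_message_sets {Ω : Type*} [MeasurableSpace Ω]
    (P : SimultaneousProtocol m Ω) {c : ℝ} (hP : P.CommunicationLT c) (hN : 0 < N) (ω : Ω) :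
    ∃ A B : Finset (List Bool),
      (∀ x : Fin N → Fin m → Bool, P.alice (.ofFamily hN x) ω ∈ A) ∧
      (∀ y : Fin N → Fin m → Bool, P.bob (.ofFamily hN y) ω ∈ B) ∧
      Real.log A.card + Real.log B.card ≤ c + 2 := by
  obtain ⟨x₀, -, hx⟩ := Finset.exists_max_image (Finset.univ : Finset (Fin N → Fin m → Bool))
    (fun x => (P.alice (.ofFamily hN x) ω).length) ⟨fun _ _ => true, Finset.mem_univ _⟩
  obtain ⟨y₀, -, hy⟩ := Finset.exists_max_image (Finset.univ : Finset (Fin N → Fin m → Bool))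
    (fun y => (P.bob (.ofFamily hN y) ω).length) ⟨fun _ _ => true, Finset.mem_univ _⟩
  obtain ⟨A, hA, hA'⟩ := exists_finset_list_length_le (P.alice (.ofFamily hN x₀) ω).length
  obtain ⟨B, hB, hB'⟩ := exists_finset_list_length_le (P.bob (.ofFamily hN y₀) ω).length
  refine ⟨A, B, fun x => hA _ (hx x (Finset.mem_univ _)),
    fun y => hB _ (hy y (Finset.mem_univ _)), ?_⟩
  have h := hP (.ofFamily hN x₀) (.ofFamily hN y₀) ω
  push_cast at h
  have h2 : Real.log 2 ≤ 1 := by linarith [Real.log_two_lt_d9]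
  have h3 := mul_le_of_le_one_right
    (by positivity : (0 : ℝ) ≤ (P.alice (.ofFamily hN x₀) ω).length + 1) h2
  have h4 := mul_le_of_le_one_right
    (by positivity : (0 : ℝ) ≤ (P.bob (.ofFamily hN y₀) ω).length + 1) h2
  linarith

open Classical in
/-- The success probability of a deterministic protocol on the hard distribution. -/
theorem sum_seedWeight_mul_isCorrectAnswer_le {M : Type*} (hN : 0 < N) {ε α : ℝ} (hε : 0 < ε)
    (hα : α = 20 / 27 + ε) (f g : BinaryXOS m → M) (out : M → M → Bool) (A B : Finset M)
    (hf : ∀ x : Fin N → Fin m → Bool, f (.ofFamily hN x) ∈ A)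
    (hg : ∀ y : Fin N → Fin m → Bool, g (.ofFamily hN y) ∈ B) {l : ℝ} (hl : 0 < l) :
    ∑ θ : Seed (Fin m → Bool) (Fin m → Bool) (Fin m → Bool) (Fin N),
      seedWeight (itemsWeight m) (aliceClauseWeight m) (bobClauseWeight m) θ *
        (if IsCorrectAnswer α m (.ofFamily hN (seedFamilies (boolCompl m) θ).1)
            (.ofFamily hN (seedFamilies (boolCompl m) θ).2)
            (out (f (.ofFamily hN (seedFamilies (boolCompl m) θ).1))
              (g (.ofFamily hN (seedFamilies (boolCompl m) θ).2))) then 1 else 0)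
      ≤ 1 / 2 * (1 + (N : ℝ)⁻¹ * ((Real.log A.card + Real.log B.card + N * (l ^ 2 / 4)) / l)
        + (N : ℝ) ^ 2 * Real.exp (-(2 * ε ^ 2 * m))) := by
  have : Nonempty (Fin N) := ⟨⟨0, hN⟩⟩
  set h : M → M → ℝ := fun a b => if out a b = true then 1 else 0 with hh
  set G : (Fin N → Fin m → Bool) → (Fin N → Fin m → Bool) → ℝ := fun x y =>
    if IsCorrectAnswer α m (.ofFamily hN x) (.ofFamily hN y)
      (out (f (.ofFamily hN x)) (g (.ofFamily hN y))) then 1 else 0 with hG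
  set H : (Fin N → Fin m → Bool) → (Fin N → Fin m → Bool) → ℝ := fun x y =>
    h (f (.ofFamily hN x)) (g (.ofFamily hN y)) with hH
  set R : (Fin N → Fin m → Bool) → (Fin N → Fin m → Bool) → ℝ := fun x y =>
    ∑ I, ∑ J, if (20 / 27 + ε) * m ≤ (unionCard (x I) (y J) : ℝ) then 1 else 0 with hR
  have hR0 : ∀ x y, 0 ≤ R x y := fun x y =>
    Finset.sum_nonneg fun I _ => Finset.sum_nonneg fun J _ => by split_ifs <;> simp
  -- On planted inputs the optimum reaches `m`, so only "yes" is correct.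
  have hplanted : plantedMean (itemsWeight m) (aliceClauseWeight m) (bobClauseWeight m)
        (boolCompl m) G
      ≤ plantedMean (itemsWeight m) (aliceClauseWeight m) (bobClauseWeight m) (boolCompl m) H := by
    refine plantedMean_mono aliceClauseWeight_nonneg bobClauseWeight_nonneg itemsWeight_nonneg
      fun x y I J z => ?_
    have hle := unionCard_le_maxUnion hN (Function.update x I z)
      (Function.update y J (boolCompl m z)) I J
    rw [Function.update_self, Function.update_self, unionCard_boolCompl] at hle
    simp only [hG, hH, hh]
    split_ifs with h1 h2 <;> try norm_num
    exact h2 (h1.1 (by exact_mod_cast hle))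
  -- On fresh inputs a correct "yes" needs a pair with a large union, and `R` counts such pairs.
  have hfresh : freshMean (itemsWeight m) (aliceClauseWeight m) (bobClauseWeight m) G
      ≤ freshMean (itemsWeight m) (aliceClauseWeight m) (bobClauseWeight m)
        (fun x y => 1 - H x y + R x y) := by
    refine freshMean_mono aliceClauseWeight_nonneg bobClauseWeight_nonneg itemsWeight_nonneg
      fun x y => ?_
    have hnn := hR0 x y
    by_cases h1 : IsCorrectAnswer α m (.ofFamily hN x) (.ofFamily hN y)
      (out (f (.ofFamily hN x)) (g (.ofFamily hN y)))
    · by_cases h2 : out (f (.ofFamily hN x)) (g (.ofFamily hN y)) = true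
      · obtain ⟨I, J, hIJ⟩ := exists_unionCard_eq_maxUnion hN x y
        have h3 : (20 / 27 + ε) * m ≤ (unionCard (x I) (y J) : ℝ) := by
          by_contra h4
          rw [not_le, ← hα, ← hIJ] at h4
          rw [h1.2 h4] at h2
          exact absurd h2 (by simp)
        have h5 : 1 ≤ R x y := by
          calc (1 : ℝ) = if (20 / 27 + ε) * m ≤ (unionCard (x I) (y J) : ℝ) then 1 else 0 := by
                rw [if_pos h3]
            _ ≤ ∑ J, if (20 / 27 + ε) * m ≤ (unionCard (x I) (y J) : ℝ) then (1 : ℝ) else 0 :=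
                Finset.single_le_sum (f := fun J =>
                  if (20 / 27 + ε) * m ≤ (unionCard (x I) (y J) : ℝ) then (1 : ℝ) else 0)
                  (fun J _ => by split_ifs <;> simp) (Finset.mem_univ J)
            _ ≤ R x y := Finset.single_le_sum (f := fun I => ∑ J,
                  if (20 / 27 + ε) * m ≤ (unionCard (x I) (y J) : ℝ) then (1 : ℝ) else 0)
                  (fun I _ => Finset.sum_nonneg fun J _ => by split_ifs <;> simp)
                  (Finset.mem_univ I)
        simp only [hG, hH, hh, if_pos h1, if_pos h2]
        linarith
      · simp only [hG, hH, hh, if_pos h1, if_neg h2]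
        linarith
    · have h3 : H x y ≤ 1 := by simp only [hH, hh]; split_ifs <;> norm_num
      simp only [hG, if_neg h1]
      linarith
  have hclose := plantedMean_sub_freshMean_le (ι := Fin N) (boolCompl m)
    typesWeight_nonneg sum_typesWeight typesWeight_nonneg sum_typesWeight
    aliceClauseWeight_nonneg sum_aliceClauseWeight bobClauseWeight_nonneg sum_bobClauseWeight
    itemsWeight_nonneg sum_itemsWeight_bob sum_itemsWeight_alice h
    (fun a b => by simp only [hh]; split_ifs <;> norm_num)
    (fun a b => by simp only [hh]; split_ifs <;> norm_num)
    (fun x => f (.ofFamily hN x)) (fun y => g (.ofFamily hN y)) A B hf hg hl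
  have hfail := freshMean_exists_le (m := m) (N := N) hε
  rw [freshMean_add, freshMean_sub,
    freshMean_one sum_aliceClauseWeight sum_bobClauseWeight sum_itemsWeight] at hfresh
  rw [Fintype.card_fin] at hclose
  have hsplit : (N : ℝ)⁻¹ * ((Real.log A.card + Real.log B.card + N * (l ^ 2 / 4)) / l)
      = (N : ℝ)⁻¹ * ((Real.log A.card + N * (l ^ 2 / 8)) / l)
        + (N : ℝ)⁻¹ * ((Real.log B.card + N * (l ^ 2 / 8)) / l) := by ring
  rw [sum_seedWeight_mul (itemsWeight m) (aliceClauseWeight m) (bobClauseWeight m) (boolCompl m) G,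
    hsplit]
  linarith

theorem SimultaneousProtocol.successProb_le_one {Ω : Type*} [MeasurableSpace Ω]
    (P : SimultaneousProtocol m Ω) (μ : Measure Ω) [IsProbabilityMeasure μ]
    (D : PMF (BinaryXOS m × BinaryXOS m)) (α X : ℝ) : P.successProb μ D α X ≤ 1 := by
  rw [← D.tsum_coe]
  exact ENNReal.tsum_le_tsum fun p => mul_le_of_le_one_right' prob_le_one

end

theorem mainTheorem2 (ε : ℝ) (hε : 0 < ε) (α C : ℝ)
    (hα : α = 3 / 4 - 1 / 108 + ε) (hC : C = 2 * ε ^ 2) (m : ℕ) :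
    ∃ D : PMF (BinaryXOS m × BinaryXOS m),
      ∀ {Ω : Type*} [MeasurableSpace Ω] (μ : MeasureTheory.Measure Ω)
        [MeasureTheory.IsProbabilityMeasure μ] (P : SimultaneousProtocol m Ω),
        P.CommunicationLT (Real.exp (2 * C * m / 9)) →
          P.successProb μ D α m ≤ ENNReal.ofReal (1 / 2 + 2 * Real.exp (-(C * m / 9))) := by
  set t := Real.exp (-(C * m / 9)) with ht
  have ht0 : 0 < t := Real.exp_pos _
  rcases le_or_gt (1 / 4) t with hbig | hsmall
  -- Here the claimed bound is at least 1, so any distribution will do.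
  · refine ⟨hardDistribution m 1 one_pos, fun {Ω} _ μ _ P _ =>
      (P.successProb_le_one μ _ α m).trans ?_⟩
    rw [← ENNReal.ofReal_one]
    exact ENNReal.ofReal_le_ofReal (by linarith)
  set T := Real.exp (2 * C * m / 9) with hT
  have hT0 : 0 < T := Real.exp_pos _
  have htT : t ^ 2 * T = 1 := by
    rw [ht, hT, ← Real.exp_nat_mul, ← Real.exp_add, ← Real.exp_zero]
    congr 1; push_cast; ring
  have hT16 : 16 ≤ T := by
    have : t ^ 2 ≤ 1 / 16 := by nlinarith
    nlinarith
  have ht9 : Real.exp (-(2 * ε ^ 2 * m)) = t ^ 9 := by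
    rw [ht, ← Real.exp_nat_mul, hC]
    congr 1; push_cast; ring
  -- With `T = t⁻²`, this size makes the information ratio `T / N` about `t ^ 2`, while the union
  -- bound `N ^ 2 * t ^ 9` stays below `t`.
  set N := ⌊T ^ 2⌋₊ with hN'
  have hNle : (N : ℝ) ≤ T ^ 2 := Nat.floor_le (by positivity)
  have hNge : T ^ 2 - 1 < N := Nat.sub_one_lt_floor _
  have hN : 0 < N := by
    have : (0 : ℝ) < N := by nlinarith
    exact_mod_cast this
  have hNR : (0 : ℝ) < N := by exact_mod_cast hN
  refine ⟨hardDistribution m N hN, fun {Ω} _ μ _ P hP => ?_⟩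
  refine P.successProb_map_le μ (fun θ => seedWeight_nonneg aliceClauseWeight_nonneg
    bobClauseWeight_nonneg itemsWeight_nonneg θ) _ _ α m _ fun ω => ?_
  obtain ⟨A, B, hA, hB, hAB⟩ := P.exists_message_sets hP hN ω
  -- The choice `l = 2 * t` balances `T / (N * l)` against `l / 4`. The errors `3 / 2 * t` and `t`
  -- are then halved, which gives `1 / 2 + 5 / 4 * t`.
  refine (sum_seedWeight_mul_isCorrectAnswer_le hN hε (by rw [hα]; ring)
    (fun v => P.alice v ω) (fun w => P.bob w ω) (fun x y => P.output x y ω) A B hA hB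
    (l := 2 * t) (by positivity)).trans ?_
  have hfail : (N : ℝ) ^ 2 * Real.exp (-(2 * ε ^ 2 * m)) ≤ t := by
    calc (N : ℝ) ^ 2 * Real.exp (-(2 * ε ^ 2 * m)) ≤ (T ^ 2) ^ 2 * t ^ 9 := by rw [ht9]; gcongr
      _ = (t ^ 2 * T) ^ 4 * t := by ring
      _ = t := by rw [htT]; ring
  have hinfo : (N : ℝ)⁻¹ * ((Real.log A.card + Real.log B.card + N * ((2 * t) ^ 2 / 4)) / (2 * t))
      ≤ 3 / 2 * t := by
    rw [inv_mul_le_iff₀ hNR, div_le_iff₀ (by positivity)]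
    have h1 : T + 2 ≤ 2 * t ^ 2 * N := by
      have h2 : t ^ 2 * (T ^ 2 - 1) ≤ t ^ 2 * N := by gcongr
      have h3 : t ^ 2 * (T ^ 2 - 1) = T - t ^ 2 := by linear_combination T * htT
      nlinarith
    nlinarith
  linarith
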